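/- Graphs are finite multigraphs with at least one vertex (parallel edges allowed; a loop would count twice in the degree). For a set $S$ of vertices of $G$, let $\partial S$ be the set of edges with precisely one end in $S$. An $r$-regular graph $G$ is an \emph{$r$-graph} if $|\partial S|\ge r$ for every $S\subseteq V(G)$ of odd cardinality. A \emph{1-factor} is a perfect matching, regarded as a set of edges. For an $r$-graph $G$ and a positive integer $k$ let $$m(r,k,G)=\max_{M_1,\dots,M_k}\frac{|\bigcup_{i=1}^k M_i|}{|E(G)|},\qquad m(r,k)=\inf_G m(r,k,G),$$ where the maximum is over all (not necessarily distinct) 1-factors $M_1,\dots,M_k$ of $G$ and the infimum is over all $r$-graphs $G$. Let $r\ge 3$ and $k\geq 1$ be integers. If $r$ is even, then $$m(r,k)\ \ge\ 1-\prod_{i=1}^k \frac{(r^2-3r+1)i-(r^2-5r+3)}{(r^2-2r-1)i-(r^2-4r-1)},$$ and if $r$ is odd, then $$m(r,k)\ \ge\ 1-\prod_{i=1}^k \frac{(r^2-2r-1)i-(r^2-4r+1)}{(r^2-r-2)i-(r^2-3r-2)}.$$ In particular, for $r=3$ we have $m(3,k)\ge 1-\prod_{i=1}^k\frac{i+1}{2i+1}$,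 and every bridgeless cubic graph $G$ has $k$ 1-factors (not necessarily distinct) covering at least the fraction $1-\prod_{i=1}^k\frac{i+1}{2i+1}$ of its edges. -/

import Mathlib

namespace Graph

/-- The edge cut `∂S`: the edges of the multigraph `G` with precisely one end in `S`. -/
def edgeCut {α β : Type*} (G : Graph α β) (S : Set α) : Set β :=
  {e | ∃ x y, G.IsLink e x y ∧ x ∈ S ∧ y ∉ S}

/-- The degree of a vertex, where every loop counts twice. -/
noncomputable def vertexDegree {α β : Type*} (G : Graph α β) (x : α) : ℕ :=
  (G.incidenceSet x).ncard + (G.loopSet x).ncard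

/-- `G` is a finite `r`-regular multigraph with at least one vertex. -/
structure IsFiniteRegular {α β : Type*} (G : Graph α β) (r : ℕ) : Prop where
  finite_vertexSet : G.vertexSet.Finite
  finite_edgeSet : G.edgeSet.Finite
  nonempty : G.vertexSet.Nonempty
  degree_eq : ∀ x ∈ G.vertexSet, G.vertexDegree x = r

/-- An `r`-graph is an `r`-regular multigraph with `|∂S| ≥ r` for every set `S` of vertices of
odd cardinality. -/
structure IsRGraph {α β : Type*} (G : Graph α β) (r : ℕ) : Prop extends G.IsFiniteRegular r where
  le_edgeCut : ∀ S ⊆ G.vertexSet, Odd S.ncard → r ≤ (G.edgeCut S).ncard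

/-- A 1-factor (perfect matching): a set of non-loop edges such that every vertex is incident with
exactly one of them. -/
structure IsOneFactor {α β : Type*} (G : Graph α β) (M : Set β) : Prop where
  subset_edgeSet : M ⊆ G.edgeSet
  not_isLoopAt : ∀ e ∈ M, ∀ x, ¬ G.IsLoopAt e x
  existsUnique : ∀ x ∈ G.vertexSet, ∃! e, e ∈ M ∧ G.Inc e x

/-- `m(r,k,G)`: the maximum fraction of the edges of `G` that is covered by `k` (not necessarily
distinct) 1-factors. The supremum is over a finite set when `G` is finite. -/
noncomputable def maxCover {α β : Type*} (G : Graph α β) (k : ℕ) : ℝ :=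
  sSup {x : ℝ | ∃ M : Fin k → Set β, (∀ i, G.IsOneFactor (M i)) ∧
    x = ((⋃ i, M i).ncard : ℝ) / (G.edgeSet.ncard : ℝ)}

/-- `m(r,k)`: the infimum of `m(r,k,G)` over all `r`-graphs `G`. -/
noncomputable def minCover (r k : ℕ) : ℝ :=
  sInf {x : ℝ | ∃ (α β : Type) (G : Graph α β), G.IsRGraph r ∧ x = G.maxCover k}

/-- The edge `e` is a bridge: its ends are not connected in `G - e`. -/
def IsBridge {α β : Type*} (G : Graph α β) (e : β) : Prop :=
  ∃ x y, G.IsLink e x y ∧ ¬ Relation.ReflTransGen (G.deleteEdges {e}).Adj x y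

end Graph

namespace Multigraph

/-- The edges with exactly one end in `S`, for a multigraph given by its end maps `s` and `t`. -/
def cut {V E : Type*} [DecidableEq V] [Fintype E] (s t : E → V) (S : Finset V) : Finset E :=
  Finset.univ.filter fun e => ¬ (s e ∈ S ↔ t e ∈ S)

/-- `M` is a perfect matching of the multigraph with end maps `s` and `t`. -/
structure IsPM {V E : Type*} [DecidableEq V] [Fintype E] [DecidableEq E] (s t : E → V)
    (M : Finset E) : Prop where
  ne : ∀ e ∈ M, s e ≠ t e
  card_star : ∀ v, (M ∩ cut s t {v}).card = 1

/-- The inequalities that describe the cone spanned by the perfect matchings. -/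
structure InCone {V E : Type*} [DecidableEq V] [Fintype E] (s t : E → V) (w : E → ℝ)
    (τ : ℝ) : Prop where
  nonneg : ∀ e, 0 ≤ w e
  loop : ∀ e, s e = t e → w e = 0
  star : ∀ v, ∑ e ∈ cut s t {v}, w e = τ
  odd : ∀ S : Finset V, Odd S.card → τ ≤ ∑ e ∈ cut s t S, w e

section Basic

variable {V E : Type*} [DecidableEq V] [Fintype E] {s t : E → V}

lemma mem_cut {S : Finset V} {e : E} : e ∈ cut s t S ↔ ¬ (s e ∈ S ↔ t e ∈ S) := by
  simp [cut]

lemma cut_compl [Fintype V] (S : Finset V) : cut s t Sᶜ = cut s t S := by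
  ext e; simp only [mem_cut, Finset.mem_compl]; tauto

lemma ne_of_mem_cut {S : Finset V} {e : E} (h : e ∈ cut s t S) : s e ≠ t e := by
  intro h'; simp [mem_cut, h'] at h

lemma mem_cut_singleton {v : V} {e : E} :
    e ∈ cut s t {v} ↔ s e ≠ t e ∧ (s e = v ∨ t e = v) := by
  simp only [mem_cut, Finset.mem_singleton]
  constructor
  · intro h
    refine ⟨fun h' => h (by rw [h']), by tauto⟩
  · rintro ⟨h, rfl | rfl⟩ h' <;> simp_all

variable {w : E → ℝ} {τ : ℝ}

lemma InCone.le (h : InCone s t w τ) (e : E) (he : 0 < w e) : w e ≤ τ := by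
  have hne : s e ≠ t e := fun h' => he.ne' (h.loop e h')
  rw [← h.star (s e)]
  exact Finset.single_le_sum (fun i _ => h.nonneg i) (mem_cut_singleton.2 ⟨hne, .inl rfl⟩)

variable [DecidableEq E]

lemma sum_indicator_cut_singleton (S : Finset V) {e : E} (h : s e ≠ t e) :
    ∑ v ∈ S, (if e ∈ cut s t {v} then 1 else 0) =
      (if s e ∈ S then 1 else 0) + (if t e ∈ S then 1 else 0) := by
  have : ∀ v, (if e ∈ cut s t {v} then 1 else 0) =
      (if s e = v then 1 else 0) + (if t e = v then 1 else 0) := by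
    intro v
    by_cases h1 : s e = v <;> by_cases h2 : t e = v <;> simp_all [mem_cut_singleton]
  simp [this, Finset.sum_add_distrib]

lemma card_inter_cut_mod_two {M : Finset E} (hM : ∀ e ∈ M, s e ≠ t e) (S : Finset V) :
    (M ∩ cut s t S).card % 2 = (∑ v ∈ S, (M ∩ cut s t {v}).card) % 2 := by
  have h1 : ∑ v ∈ S, (M ∩ cut s t {v}).card =
      ∑ e ∈ M, ∑ v ∈ S, (if e ∈ cut s t {v} then 1 else 0) := by
    rw [Finset.sum_comm]
    refine Finset.sum_congr rfl fun v _ => ?_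
    rw [← Finset.card_filter, Finset.filter_mem_eq_inter]
  rw [h1, ← Finset.filter_mem_eq_inter, Finset.card_filter, Finset.sum_nat_mod M 2,
    Finset.sum_nat_mod M 2 (fun e => ∑ v ∈ S, _)]
  congr 1
  refine Finset.sum_congr rfl fun e he => ?_
  rw [sum_indicator_cut_singleton S (hM e he)]
  by_cases h2 : s e ∈ S <;> by_cases h3 : t e ∈ S <;> simp [mem_cut, h2, h3]

lemma IsPM.card_inter_cut_mod_two {M : Finset E} (hM : IsPM s t M)
    (S : Finset V) : (M ∩ cut s t S).card % 2 = S.card % 2 := by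
  rw [Multigraph.card_inter_cut_mod_two hM.ne S, Finset.sum_congr rfl fun v _ => hM.card_star v]
  simp

lemma IsPM.one_le_card_inter_cut {M : Finset E} (hM : IsPM s t M)
    {S : Finset V} (hS : Odd S.card) : 1 ≤ (M ∩ cut s t S).card := by
  have := hM.card_inter_cut_mod_two S
  rw [Nat.odd_iff] at hS
  omega

lemma InCone.sum_star (h : InCone s t w τ) (U : Finset V) :
    ∑ e, ((if s e ∈ U then 1 else 0) + (if t e ∈ U then 1 else 0)) * w e = U.card * τ := by
  have : (U.card : ℝ) * τ = ∑ v ∈ U, ∑ e ∈ cut s t {v}, w e := by simp [h.star]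
  rw [this]
  have h2 : ∀ v, ∑ e ∈ cut s t {v}, w e = ∑ e, (if e ∈ cut s t {v} then 1 else 0) * w e := by
    intro v; simp
  simp_rw [h2]
  rw [Finset.sum_comm]
  refine Finset.sum_congr rfl fun e _ => ?_
  by_cases hne : s e = t e
  · simp [h.loop e hne]
  · rw [← Finset.sum_mul]
    congr 1
    have := sum_indicator_cut_singleton U hne
    exact_mod_cast this.symm

end Basic

/-- The simple graph of the edges of positive weight. -/
def supportGraph {V E : Type*} (s t : E → V) (w : E → ℝ) : SimpleGraph V :=
  SimpleGraph.fromRel fun u v => ∃ e, 0 < w e ∧ s e = u ∧ t e = v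

lemma supportGraph_adj {V E : Type*} {s t : E → V} {w : E → ℝ} {u v : V} :
    (supportGraph s t w).Adj u v ↔
      u ≠ v ∧ ∃ e, 0 < w e ∧ (s e = u ∧ t e = v ∨ s e = v ∧ t e = u) := by
  simp only [supportGraph, SimpleGraph.fromRel_adj, and_congr_right_iff]
  intro _
  constructor
  · rintro (⟨e, h1, h2⟩ | ⟨e, h1, h2⟩)
    · exact ⟨e, h1, .inl h2⟩
    · exact ⟨e, h1, .inr h2⟩
  · rintro ⟨e, h1, h2 | h2⟩
    · exact .inl ⟨e, h1, h2⟩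
    · exact .inr ⟨e, h1, h2⟩

lemma InCone.not_isTutteViolator {V E : Type*} [Fintype V] [DecidableEq V] [Fintype E]
    {s t : E → V} {w : E → ℝ} {τ : ℝ} (h : InCone s t w τ) (hτ : 0 < τ) (U : Set V) :
    ¬ (supportGraph s t w).IsTutteViolator U := by
  classical
  unfold SimpleGraph.IsTutteViolator
  rw [not_lt]
  set H := ((⊤ : (supportGraph s t w).Subgraph).deleteVerts U).coe with hH
  have hfin : H.oddComponents.Finite := Set.toFinite _
  set T : Finset H.ConnectedComponent := hfin.toFinset with hT
  have hcardT : H.oddComponents.ncard = T.card := Set.ncard_eq_toFinset_card _ hfin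
  have hcardU : U.ncard = U.toFinset.card := Set.ncard_eq_toFinset_card' U
  rw [hcardT, hcardU]
  let K : H.ConnectedComponent → Finset V := fun c => (Subtype.val '' c.supp).toFinset
  have hmemK : ∀ c v, v ∈ K c ↔ ∃ hv, (⟨v, hv⟩ : _) ∈ c.supp := by
    intro c v; simp [K]
  have hdisj : ∀ v, ∑ c ∈ T, (if v ∈ K c then (1 : ℝ) else 0) ≤ if v ∈ U then 0 else 1 := by
    intro v
    by_cases hv : v ∈ U
    · rw [if_pos hv]
      refine (Finset.sum_eq_zero fun c _ => ?_).le
      rw [if_neg]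
      rw [hmemK]
      rintro ⟨hv', -⟩
      simp at hv'
      exact hv' hv
    · rw [if_neg hv]
      have hv' : v ∈ ((⊤ : (supportGraph s t w).Subgraph).deleteVerts U).verts := by simp [hv]
      calc _ ≤ ∑ c ∈ T, (if c = H.connectedComponentMk ⟨v, hv'⟩ then (1 : ℝ) else 0) := by
            refine Finset.sum_le_sum fun c _ => ?_
            by_cases hc : v ∈ K c
            · obtain ⟨_, h2⟩ := (hmemK c v).1 hc
              rw [if_pos hc, if_pos]
              exact h2.symm
            · rw [if_neg hc]; split_ifs <;> norm_num
        _ ≤ 1 := by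
            rw [Finset.sum_ite_eq']; split_ifs <;> norm_num
  have hkey : ∀ c ∈ T, τ ≤ ∑ e, ((if s e ∈ K c then 1 else 0) * (if t e ∈ U then 1 else 0) +
      (if t e ∈ K c then 1 else 0) * (if s e ∈ U then 1 else 0)) * w e := by
    intro c hc
    have hodd : Odd (K c).card := by
      have : (K c).card = c.supp.ncard := by
        rw [← Set.ncard_eq_toFinset_card']
        exact Set.ncard_image_of_injective _ Subtype.val_injective
      rw [this]
      simpa [hT] using hc
    refine (h.odd (K c) hodd).trans ?_
    have : ∑ e ∈ cut s t (K c), w e = ∑ e, (if e ∈ cut s t (K c) then 1 else 0) * w e := by simp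
    rw [this]
    refine Finset.sum_le_sum fun e _ => ?_
    rcases (h.nonneg e).eq_or_lt with h0 | h0
    · simp [← h0]
    refine mul_le_mul_of_nonneg_right ?_ h0.le
    have hstep : ∀ u v, (supportGraph s t w).Adj u v → u ∈ K c → v ∉ K c → v ∈ U := by
      intro u v huv hu hv
      by_contra hvU
      apply hv
      obtain ⟨hu1, hu2⟩ := (hmemK c u).1 hu
      have hv' : v ∈ ((⊤ : (supportGraph s t w).Subgraph).deleteVerts U).verts := by simp [hvU]
      refine (hmemK c v).2 ⟨hv', ?_⟩
      refine (c.mem_supp_congr_adj ?_).1 hu2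
      simp only [SimpleGraph.Subgraph.coe_adj, hH]
      simp at hu1
      simp [huv, hvU, hu1]
    by_cases hne : s e = t e
    · exact absurd (h.loop e hne) h0.ne'
    by_cases h1 : s e ∈ K c <;> by_cases h2 : t e ∈ K c
    · simp only [mem_cut, h1, h2]; simp; split_ifs <;> norm_num
    · have := hstep (s e) (t e) (supportGraph_adj.2 ⟨hne, e, h0, .inl ⟨rfl, rfl⟩⟩) h1 h2
      simp [mem_cut, h1, h2, this]
    · have := hstep (t e) (s e) (supportGraph_adj.2 ⟨Ne.symm hne, e, h0, .inr ⟨rfl, rfl⟩⟩) h2 h1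
      simp [mem_cut, h1, h2, this]
    · simp [mem_cut, h1, h2]
  have htot : (T.card : ℝ) * τ ≤ U.toFinset.card * τ := by
    calc (T.card : ℝ) * τ = ∑ c ∈ T, τ := by simp
      _ ≤ _ := Finset.sum_le_sum hkey
      _ = ∑ e, ((∑ c ∈ T, if s e ∈ K c then 1 else 0) * (if t e ∈ U then 1 else 0) +
            (∑ c ∈ T, if t e ∈ K c then 1 else 0) * (if s e ∈ U then 1 else 0)) * w e := by
          rw [Finset.sum_comm]
          refine Finset.sum_congr rfl fun e _ => ?_
          rw [← Finset.sum_mul, Finset.sum_add_distrib, ← Finset.sum_mul, ← Finset.sum_mul]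
      _ ≤ ∑ e, ((if s e ∈ U.toFinset then 1 else 0) + (if t e ∈ U.toFinset then 1 else 0)) *
            w e := by
          refine Finset.sum_le_sum fun e _ => mul_le_mul_of_nonneg_right ?_ (h.nonneg e)
          have h1 := hdisj (s e)
          have h2 := hdisj (t e)
          simp only [Set.mem_toFinset]
          by_cases hs : s e ∈ U <;> by_cases ht : t e ∈ U <;>
            simp only [hs, ht, if_true, if_false] at h1 h2 ⊢ <;> linarith
      _ = _ := h.sum_star _
  exact_mod_cast le_of_mul_le_mul_right htot hτ

lemma InCone.exists_isPM {V E : Type*} [Fintype V] [DecidableEq V] [Fintype E] [DecidableEq E]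
    {s t : E → V} {w : E → ℝ} {τ : ℝ} (h : InCone s t w τ) (hτ : 0 < τ) :
    ∃ M, IsPM s t M ∧ ∀ e ∈ M, 0 < w e := by
  classical
  obtain ⟨M, hM⟩ := SimpleGraph.tutte.2 (h.not_isTutteViolator hτ)
  have hM' := SimpleGraph.Subgraph.isPerfectMatching_iff.1 hM
  have hex : ∀ z : Sym2 V, z ∈ M.edgeSet → ∃ e, 0 < w e ∧ s(s e, t e) = z := by
    intro z
    induction z using Sym2.ind with
    | _ u v =>
      intro hz
      obtain ⟨-, e, h1, h2⟩ := supportGraph_adj.1 (M.adj_sub hz)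
      exact ⟨e, h1, Sym2.eq_iff.2 h2⟩
  rcases isEmpty_or_nonempty V with _ | ⟨⟨v₀⟩⟩
  · exact ⟨∅, ⟨by simp, fun v => isEmptyElim v⟩, by simp⟩
  obtain ⟨u₀, hu₀, -⟩ := hM' v₀
  have : Nonempty E := ⟨(hex s(v₀, u₀) hu₀).choose⟩
  choose! f hf1 hf2 using hex
  refine ⟨Finset.univ.filter fun e => s(s e, t e) ∈ M.edgeSet ∧ f s(s e, t e) = e, ⟨?_, ?_⟩, ?_⟩
  · intro e he
    simp only [Finset.mem_filter] at he
    exact (M.adj_sub he.2.1).ne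
  · intro v
    obtain ⟨u, hu, huniq⟩ := hM' v
    rw [Finset.card_eq_one]
    refine ⟨f s(v, u), ?_⟩
    ext e
    simp only [Finset.mem_inter, Finset.mem_filter, Finset.mem_univ, true_and,
      mem_cut_singleton, Finset.mem_singleton]
    constructor
    · rintro ⟨⟨h1, h2⟩, -, h3⟩
      rw [← h2]
      rcases h3 with h3 | h3
      · subst h3; rw [← huniq _ h1]
      · subst h3; rw [Sym2.eq_swap, ← huniq _ (M.adj_comm _ _ |>.1 h1)]
    · rintro rfl
      have hz : s(v, u) ∈ M.edgeSet := hu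
      have h2 := hf2 _ hz
      refine ⟨by rw [h2]; exact ⟨hz, rfl⟩, ?_, ?_⟩
      · have : M.Adj (s (f s(v, u))) (t (f s(v, u))) := by
          rw [← SimpleGraph.Subgraph.mem_edgeSet, h2]; exact hz
        exact (M.adj_sub this).ne
      · rcases Sym2.eq_iff.1 h2 with h3 | h3
        · exact .inl h3.1
        · exact .inr h3.2
  · intro e he
    simp only [Finset.mem_filter] at he
    rw [← he.2.2]
    exact hf1 _ he.2.1

end Multigraph

namespace Multigraph

/-- `w` is a nonnegative combination of indicators of perfect matchings. -/
def IsPMSum {V E : Type*} [DecidableEq V] [Fintype E] [DecidableEq E] (s t : E → V)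
    (w : E → ℝ) : Prop :=
  ∃ l : Finset E → ℝ, (∀ M, 0 ≤ l M) ∧ (∀ M, l M ≠ 0 → IsPM s t M) ∧
    ∀ e, w e = ∑ M, if e ∈ M then l M else 0

lemma isPMSum_of_family {V E ι : Type*} [DecidableEq V] [Fintype E] [DecidableEq E] [Fintype ι]
    {s t : E → V} {w : E → ℝ} (m : ι → Finset E) (l : ι → ℝ) (h0 : ∀ i, 0 ≤ l i)
    (hm : ∀ i, l i ≠ 0 → IsPM s t (m i)) (hw : ∀ e, w e = ∑ i, if e ∈ m i then l i else 0) :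
    IsPMSum s t w := by
  classical
  refine ⟨fun M => ∑ i with m i = M, l i, fun M => Finset.sum_nonneg fun i _ => h0 i, ?_, ?_⟩
  · intro M hM
    obtain ⟨i, hi, hi'⟩ := Finset.exists_ne_zero_of_sum_ne_zero hM
    simp only [Finset.mem_filter] at hi
    exact hi.2 ▸ hm i hi'
  · intro e
    rw [hw, ← Finset.sum_fiberwise (g := m)]
    refine Finset.sum_congr rfl fun M _ => ?_
    split_ifs with he
    · refine Finset.sum_congr rfl fun i hi => ?_
      simp only [Finset.mem_filter] at hi
      rw [if_pos (hi.2 ▸ he)]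
    · refine Finset.sum_eq_zero fun i hi => ?_
      simp only [Finset.mem_filter] at hi
      rw [if_neg (hi.2 ▸ he)]

section Glue

variable {E : Type*} [DecidableEq E]

/-- The weight of the pair `(M, N)` glued along the edge `e` of `C`. -/
noncomputable def glueWeight (C : Finset E) (l l' : Finset E → ℝ) (w : E → ℝ) (M N : Finset E)
    (e : E) : ℝ :=
  if e ∈ C ∧ e ∈ M ∧ e ∈ N then l M * l' N / w e else 0

lemma glueWeight_comm (C : Finset E) (l l' : Finset E → ℝ) (w : E → ℝ) (M N : Finset E)
    (e : E) : glueWeight C l l' w M N e = glueWeight C l' l w N M e := by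
  simp only [glueWeight, mul_comm (l M), and_comm (a := e ∈ M)]

variable [Fintype E] {C : Finset E} {l l' : Finset E → ℝ} {w : E → ℝ}

lemma sum_glueWeight_of_notMem (h0 : ∀ M, 0 ≤ l M)
    (hC : ∀ M, l M ≠ 0 → (M ∩ C).card = 1)
    (hw : ∀ e ∈ C, w e = ∑ M, if e ∈ M then l M else 0)
    (hw' : ∀ e ∈ C, w e = ∑ M, if e ∈ M then l' M else 0) {f : E}
    (hf : ∀ N, l' N ≠ 0 → f ∉ N) :
    ∑ M, ∑ N, ∑ e, (if f ∈ M ∪ N then glueWeight C l l' w M N e else 0) =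
      ∑ M, if f ∈ M then l M else 0 := by
  refine Finset.sum_congr rfl fun M _ => ?_
  by_cases hM : l M = 0
  · simp [glueWeight, hM]
  obtain ⟨e₀, he₀⟩ := Finset.card_eq_one.1 (hC M hM)
  have hiff : ∀ e, e ∈ C ∧ e ∈ M ↔ e = e₀ := by
    intro e
    rw [← Finset.mem_singleton, ← he₀, Finset.mem_inter, and_comm]
  have he₀C := ((hiff e₀).2 rfl).1
  have he₀M := ((hiff e₀).2 rfl).2
  have hpos : 0 < w e₀ := by
    have h1 : l M ≤ w e₀ := by
      rw [hw e₀ he₀C]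
      refine le_trans (by rw [if_pos he₀M]) (Finset.single_le_sum
        (f := fun M => if e₀ ∈ M then l M else 0) (fun M _ => ?_) (Finset.mem_univ M))
      split_ifs
      exacts [h0 M, le_rfl]
    exact lt_of_lt_of_le (lt_of_le_of_ne (h0 M) (Ne.symm hM)) h1
  have hterm : ∀ N e, (if f ∈ M ∪ N then glueWeight C l l' w M N e else 0) =
      if e = e₀ then (if f ∈ M then (if e₀ ∈ N then l' N else 0) * (l M / w e₀) else 0) else 0 := by
    intro N e
    simp only [glueWeight, ← and_assoc, hiff, Finset.mem_union]
    by_cases hN : l' N = 0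
    · simp [hN]
    have := hf N hN
    by_cases h1 : e = e₀
    · subst h1
      simp only [this, or_false, true_and, if_true]
      split_ifs <;> ring
    · simp [h1]
  simp only [hterm, Finset.sum_ite_eq', Finset.mem_univ, if_true]
  split_ifs
  · rw [← Finset.sum_mul, ← hw' e₀ he₀C]
    field_simp
  · simp

lemma sum_glueWeight_of_mem (hC : ∀ M, l M ≠ 0 → (M ∩ C).card = 1)
    (hC' : ∀ M, l' M ≠ 0 → (M ∩ C).card = 1)
    (hw : ∀ e ∈ C, w e = ∑ M, if e ∈ M then l M else 0)
    (hw' : ∀ e ∈ C, w e = ∑ M, if e ∈ M then l' M else 0) {f : E} (hf : f ∈ C) :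
    ∑ M, ∑ N, ∑ e, (if f ∈ M ∪ N then glueWeight C l l' w M N e else 0) = w f := by
  have hone : ∀ M : Finset E, (M ∩ C).card = 1 → ∀ e ∈ C, e ∈ M → f ∈ M → e = f := by
    intro M hM e he he' hf'
    exact Finset.card_le_one.1 hM.le _ (Finset.mem_inter.2 ⟨he', he⟩) _
      (Finset.mem_inter.2 ⟨hf', hf⟩)
  have hterm : ∀ M N e, (if f ∈ M ∪ N then glueWeight C l l' w M N e else 0) =
      if e = f then (if f ∈ M then l M else 0) * (if f ∈ N then l' N else 0) / w f else 0 := by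
    intro M N e
    by_cases hM : l M = 0
    · simp [hM, glueWeight]
    by_cases hN : l' N = 0
    · simp [hN, glueWeight]
    by_cases h1 : e = f
    · subst h1
      by_cases h2 : e ∈ M <;> by_cases h3 : e ∈ N <;> simp [glueWeight, h2, h3, hf]
    · rw [if_neg h1]
      split_ifs with h2
      · rw [glueWeight, if_neg]
        rintro ⟨h3, h4, h5⟩
        rcases Finset.mem_union.1 h2 with h2 | h2
        · exact h1 (hone M (hC M hM) e h3 h4 h2)
        · exact h1 (hone N (hC' N hN) e h3 h5 h2)
      · rfl
  simp only [hterm, Finset.sum_ite_eq', Finset.mem_univ, if_true]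
  simp only [← Finset.sum_div, ← Finset.mul_sum, ← Finset.sum_mul, ← hw f hf, ← hw' f hf]
  by_cases h : w f = 0
  · simp [h]
  · field_simp

end Glue

/-- `M` restricts to a perfect matching after contracting the complement of `T`. -/
structure IsPMOn {V E : Type*} [DecidableEq V] [Fintype E] [DecidableEq E] (s t : E → V)
    (T : Finset V) (M : Finset E) : Prop where
  card_star : ∀ v ∈ T, (M ∩ cut s t {v}).card = 1
  ne : ∀ e ∈ M, s e ≠ t e
  mem : ∀ e ∈ M, s e ∈ T ∨ t e ∈ T
  card_cut : (M ∩ cut s t T).card = 1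

section Contract

variable {V E : Type*} [DecidableEq V] {s t : E → V}

/-- The map that contracts `S` to one vertex. -/
def contract (S : Finset V) (v : V) : Option {v // v ∉ S} :=
  if h : v ∈ S then none else some ⟨v, h⟩

lemma contract_eq_none {S : Finset V} {v : V} : contract S v = none ↔ v ∈ S := by
  unfold contract; split_ifs <;> simp [*]

lemma contract_eq_some {S : Finset V} {v : V} {u : {v // v ∉ S}} :
    contract S v = some u ↔ v = u := by
  unfold contract
  split_ifs with h
  · simp only [false_iff]
    rintro rfl
    exact u.2 h
  · rw [Option.some.injEq, Subtype.ext_iff]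

variable [Fintype V] [Fintype E]

lemma cut_comp {V' : Type*} [DecidableEq V'] (π : V → V') (S : Finset V') :
    cut (π ∘ s) (π ∘ t) S = cut s t (Finset.univ.filter fun v => π v ∈ S) := by
  ext e; simp [mem_cut]

lemma InCone.map {V' : Type*} [Fintype V'] [DecidableEq V'] {w : E → ℝ} {τ : ℝ}
    (h : InCone s t w τ) (π : V → V')
    (hodd : ∀ u, Odd (Finset.univ.filter fun v => π v = u).card)
    (hτ : ∀ u, ∑ e ∈ cut s t (Finset.univ.filter fun v => π v = u), w e = τ) :
    InCone (π ∘ s) (π ∘ t) (fun e => if π (s e) = π (t e) then 0 else w e) τ := by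
  have hsum : ∀ S, ∑ e ∈ cut (π ∘ s) (π ∘ t) S, (if π (s e) = π (t e) then 0 else w e) =
      ∑ e ∈ cut s t (Finset.univ.filter fun v => π v ∈ S), w e := by
    intro S
    rw [← cut_comp]
    refine Finset.sum_congr rfl fun e he => ?_
    rw [if_neg]
    exact ne_of_mem_cut he
  refine ⟨?_, ?_, ?_, ?_⟩
  · intro e; split_ifs
    exacts [le_rfl, h.nonneg e]
  · intro e he; exact if_pos he
  · intro u
    rw [hsum, ← hτ u]
    simp
  · intro S hS
    rw [hsum]
    refine h.odd _ ?_
    rw [Finset.card_eq_sum_card_fiberwise (f := π) (t := S) (fun v hv => by simpa using hv)]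
    have : ∀ u ∈ S, ((Finset.univ.filter fun v => π v ∈ S).filter fun v => π v = u) =
        Finset.univ.filter fun v => π v = u := by
      intro u hu; ext v; simp only [Finset.mem_filter, Finset.mem_univ, true_and]
      constructor
      · exact fun h => h.2
      · rintro rfl; exact ⟨hu, rfl⟩
    rw [Finset.sum_congr rfl fun u hu => by rw [this u hu], Finset.odd_sum_iff_odd_card_odd,
      Finset.filter_true_of_mem fun u _ => hodd u]
    exact hS

lemma filter_contract_none (S : Finset V) :
    (Finset.univ.filter fun v => contract S v = none) = S := by
  ext v; simp [contract_eq_none]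

lemma filter_contract_some {S : Finset V} (u : {v // v ∉ S}) :
    (Finset.univ.filter fun v => contract S v = some u) = {u.1} := by
  ext v; simp [contract_eq_some]

lemma cut_contract_none (S : Finset V) :
    cut (contract S ∘ s) (contract S ∘ t) {none} = cut s t S := by
  rw [cut_comp]; simp only [Finset.mem_singleton, filter_contract_none]

lemma cut_contract_some {S : Finset V} (u : {v // v ∉ S}) :
    cut (contract S ∘ s) (contract S ∘ t) {some u} = cut s t {u.1} := by
  rw [cut_comp]; simp only [Finset.mem_singleton, filter_contract_some]

variable [DecidableEq E]

lemma IsPMOn.union {S : Finset V} {M N : Finset E} (hM : IsPMOn s t Sᶜ M) (hN : IsPMOn s t S N)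
    {e : E} (he : e ∈ cut s t S) (heM : e ∈ M) (heN : e ∈ N) : IsPM s t (M ∪ N) := by
  refine ⟨?_, ?_⟩
  · intro f hf
    rcases Finset.mem_union.1 hf with hf | hf
    exacts [hM.ne f hf, hN.ne f hf]
  · intro v
    by_cases hv : v ∈ S
    · rw [← hN.card_star v hv]
      congr 1
      ext f
      simp only [Finset.mem_inter, Finset.mem_union, and_congr_left_iff, or_iff_right_iff_imp]
      intro hfv hfM
      have hfC : f ∈ cut s t Sᶜ := by
        have h1 := hM.mem f hfM
        rw [mem_cut_singleton] at hfv
        simp only [mem_cut, Finset.mem_compl] at h1 ⊢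
        rcases hfv with ⟨-, rfl | rfl⟩ <;> tauto
      have := Finset.card_le_one.1 hM.card_cut.le f (Finset.mem_inter.2 ⟨hfM, hfC⟩) e
        (Finset.mem_inter.2 ⟨heM, by rwa [cut_compl]⟩)
      exact this ▸ heN
    · rw [← hM.card_star v (Finset.mem_compl.2 hv)]
      congr 1
      ext f
      simp only [Finset.mem_inter, Finset.mem_union, and_congr_left_iff, or_iff_left_iff_imp]
      intro hfv hfN
      have hfC : f ∈ cut s t S := by
        have h1 := hN.mem f hfN
        rw [mem_cut_singleton] at hfv
        simp only [mem_cut] at h1 ⊢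
        rcases hfv with ⟨-, rfl | rfl⟩ <;> tauto
      have := Finset.card_le_one.1 hN.card_cut.le f (Finset.mem_inter.2 ⟨hfN, hfC⟩) e
        (Finset.mem_inter.2 ⟨heN, he⟩)
      exact this ▸ heM

lemma isPMSum_of_isPMOn {S : Finset V} {l l' : Finset E → ℝ} {w : E → ℝ}
    (h0 : ∀ M, 0 ≤ l M) (h0' : ∀ M, 0 ≤ l' M) (hw0 : ∀ e, 0 ≤ w e)
    (hM : ∀ M, l M ≠ 0 → IsPMOn s t Sᶜ M) (hN : ∀ M, l' M ≠ 0 → IsPMOn s t S M)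
    (hw : ∀ e, s e ∈ Sᶜ ∨ t e ∈ Sᶜ → w e = ∑ M, if e ∈ M then l M else 0)
    (hw' : ∀ e, s e ∈ S ∨ t e ∈ S → w e = ∑ M, if e ∈ M then l' M else 0) :
    IsPMSum s t w := by
  have hC : ∀ M, l M ≠ 0 → (M ∩ cut s t S).card = 1 := fun M h => by
    rw [← cut_compl]; exact (hM M h).card_cut
  have hC' : ∀ M, l' M ≠ 0 → (M ∩ cut s t S).card = 1 := fun M h => (hN M h).card_cut
  have hwC : ∀ e ∈ cut s t S, w e = ∑ M, if e ∈ M then l M else 0 := fun e he => by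
    refine hw e ?_
    simp only [mem_cut, Finset.mem_compl] at he ⊢
    tauto
  have hwC' : ∀ e ∈ cut s t S, w e = ∑ M, if e ∈ M then l' M else 0 := fun e he => by
    refine hw' e ?_
    simp only [mem_cut] at he
    tauto
  refine isPMSum_of_family (ι := Finset E × Finset E × E) (fun p => p.1 ∪ p.2.1)
    (fun p => glueWeight (cut s t S) l l' w p.1 p.2.1 p.2.2) ?_ ?_ ?_
  · rintro ⟨M, N, e⟩
    simp only [glueWeight]
    split_ifs
    exacts [div_nonneg (mul_nonneg (h0 M) (h0' N)) (hw0 e), le_rfl]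
  · rintro ⟨M, N, e⟩ h
    simp only [glueWeight] at h
    split_ifs at h with he
    · refine (hM M ?_).union (hN N ?_) he.1 he.2.1 he.2.2 <;> rintro h1 <;> simp [h1] at h
    · exact absurd rfl h
  · intro f
    simp only [Fintype.sum_prod_type]
    by_cases hf : f ∈ cut s t S
    · rw [sum_glueWeight_of_mem hC hC' hwC hwC' hf]
    by_cases hfS : s f ∈ S
    · have hft : t f ∈ S := by simp only [mem_cut] at hf; tauto
      rw [hw' f (.inl hfS), ← sum_glueWeight_of_notMem h0' hC' hwC' hwC (f := f), Finset.sum_comm]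
      · refine Finset.sum_congr rfl fun M _ => Finset.sum_congr rfl fun N _ =>
          Finset.sum_congr rfl fun e _ => ?_
        rw [Finset.union_comm, glueWeight_comm]
      · intro N h h1
        have := (hM N h).mem f h1
        simp [hfS, hft] at this
    · have hft : t f ∉ S := by simp only [mem_cut] at hf; tauto
      rw [hw f (by simp [hfS]), ← sum_glueWeight_of_notMem h0 hC hwC hwC' (f := f)]
      intro N h h1
      have := (hN N h).mem f h1
      simp [hfS, hft] at this

lemma IsPM.isPMOn_of_contract {S : Finset V} {M : Finset E}
    (h : IsPM (contract S ∘ s) (contract S ∘ t) M) : IsPMOn s t Sᶜ M := by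
  refine ⟨?_, ?_, ?_, ?_⟩
  · intro v hv
    rw [← h.card_star (some ⟨v, by simpa using hv⟩), cut_contract_some]
  · intro e he h'
    exact h.ne e he (congrArg (contract S) h')
  · intro e he
    by_contra! h'
    simp only [Finset.mem_compl, not_not] at h'
    exact h.ne e he ((contract_eq_none.2 h'.1).trans (contract_eq_none.2 h'.2).symm)
  · rw [cut_compl, ← h.card_star none, cut_contract_none]

lemma card_option_notMem_lt {S : Finset V} (h : 1 < S.card) :
    Fintype.card (Option {v // v ∉ S}) < Fintype.card V := by
  have h1 : Fintype.card {v // v ∉ S} = Sᶜ.card := by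
    rw [Fintype.card_subtype]; congr 1; ext; simp
  rw [Fintype.card_option, h1, ← Finset.card_add_card_compl S]
  omega

lemma InCone.exists_isPMOn {w : E → ℝ} {τ : ℝ} (h : InCone s t w τ) {S : Finset V}
    (hS : Odd S.card) (htight : ∑ e ∈ cut s t S, w e = τ)
    (ih : ∀ w', InCone (contract S ∘ s) (contract S ∘ t) w' τ →
      IsPMSum (contract S ∘ s) (contract S ∘ t) w') :
    ∃ l : Finset E → ℝ, (∀ M, 0 ≤ l M) ∧ (∀ M, l M ≠ 0 → IsPMOn s t Sᶜ M) ∧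
      ∀ e, s e ∈ Sᶜ ∨ t e ∈ Sᶜ → w e = ∑ M, if e ∈ M then l M else 0 := by
  obtain ⟨l, h0, hl, hw⟩ := ih _ (h.map (contract S) (by
    rintro (_ | u)
    · rwa [filter_contract_none]
    · rw [filter_contract_some]; simp) (by
    rintro (_ | u)
    · rw [filter_contract_none, htight]
    · rw [filter_contract_some, h.star]))
  refine ⟨l, h0, fun M hM => (hl M hM).isPMOn_of_contract, fun e he => ?_⟩
  rw [← hw e]
  dsimp only
  split_ifs with h1
  · apply h.loop
    simp only [Finset.mem_compl] at he
    rcases he with he | he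
    · exact (contract_eq_some (u := ⟨_, he⟩).1 (h1 ▸ contract_eq_some.2 rfl)).symm
    · exact contract_eq_some (u := ⟨_, he⟩).1 (h1 ▸ contract_eq_some.2 rfl)
  · rfl

end Contract

/-- A tight odd cut that is not a star. -/
structure IsNontrivialTight {V E : Type*} [Fintype V] [DecidableEq V] [Fintype E] (s t : E → V)
    (w : E → ℝ) (τ : ℝ) (S : Finset V) : Prop where
  odd : Odd S.card
  one_lt : 1 < S.card
  one_lt_compl : 1 < Sᶜ.card
  tight : ∑ e ∈ cut s t S, w e = τ

section Main

lemma IsPMSum.of_tau_nonpos {V E : Type*} [DecidableEq V] [Fintype E] [DecidableEq E]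
    {s t : E → V} {w : E → ℝ} {τ : ℝ} (h : InCone s t w τ) (hτ : τ ≤ 0) : IsPMSum s t w := by
  refine ⟨0, by simp, by simp, fun e => ?_⟩
  have := h.nonneg e
  by_contra h1
  simp only [Pi.zero_apply, ite_self, Finset.sum_const_zero] at h1
  have h2 := h.le e (lt_of_le_of_ne this (Ne.symm h1))
  exact h1 (by linarith)

lemma exists_max_step {ι : Type*} [Fintype ι] (a b : ι → ℝ) (ha : ∀ i, 0 ≤ a i)
    (hab : ∀ i, 0 < b i → 0 < a i) (hb : ∃ i, 0 < b i) :
    ∃ ε : ℝ, 0 < ε ∧ (∀ i, ε * b i ≤ a i) ∧ ∃ i, 0 < b i ∧ a i = ε * b i := by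
  classical
  obtain ⟨i₀, hi₀⟩ := hb
  obtain ⟨i, hi, hmin⟩ := Finset.exists_min_image (Finset.univ.filter fun i => 0 < b i)
    (fun i => a i / b i) ⟨i₀, by simpa using hi₀⟩
  simp only [Finset.mem_filter, Finset.mem_univ, true_and] at hi hmin
  refine ⟨a i / b i, div_pos (hab i hi) hi, fun j => ?_, i, hi, by field_simp⟩
  by_cases hj : 0 < b j
  · rw [← le_div_iff₀ hj]; exact hmin j hj
  · exact (mul_nonpos_of_nonneg_of_nonpos (div_pos (hab i hi) hi).le (not_lt.1 hj)).trans (ha j)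

lemma InCone.exists_sub {V E : Type*} [Fintype V] [DecidableEq V] [Fintype E] [DecidableEq E]
    {s t : E → V} {w : E → ℝ} {τ : ℝ} (h : InCone s t w τ) (hτ : 0 < τ) [Nonempty V]
    (hnt : ∀ S, ¬ IsNontrivialTight s t w τ S) :
    ∃ (M : Finset E) (ε : ℝ), IsPM s t M ∧ 0 < ε ∧
      InCone s t (fun e => w e - if e ∈ M then ε else 0) (τ - ε) ∧
      ((∃ e, 0 < w e ∧ (w e - if e ∈ M then ε else 0) = 0) ∨
        ∃ S, IsNontrivialTight s t (fun e => w e - if e ∈ M then ε else 0) (τ - ε) S) := by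
  classical
  obtain ⟨M, hM, hpos⟩ := h.exists_isPM hτ
  have hnontriv : ∀ S : Finset V, Odd S.card → 1 < (M ∩ cut s t S).card →
      1 < S.card ∧ 1 < Sᶜ.card := by
    intro S hS hc
    constructor
    · by_contra h1
      obtain ⟨v, rfl⟩ := Finset.card_eq_one.1 (le_antisymm (not_lt.1 h1) hS.pos)
      have := hM.card_star v
      omega
    · by_contra h1
      rw [← cut_compl] at hc
      rcases Nat.le_one_iff_eq_zero_or_eq_one.1 (not_lt.1 h1) with h2 | h2
      · rw [Finset.card_eq_zero.1 h2] at hc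
        simp [cut] at hc
      · obtain ⟨v, hv⟩ := Finset.card_eq_one.1 h2
        rw [hv, hM.card_star v] at hc
        omega
  obtain ⟨ε, hε, hle, i, hi, hieq⟩ := exists_max_step
    (ι := E ⊕ {S : Finset V // Odd S.card})
    (Sum.elim w fun S => ∑ e ∈ cut s t S.1, w e - τ)
    (Sum.elim (fun e => if e ∈ M then 1 else 0) fun S => ((M ∩ cut s t S.1).card : ℝ) - 1)
    (by
      rintro (e | S)
      · exact h.nonneg e
      · exact sub_nonneg.2 (h.odd S.1 S.2))
    (by
      rintro (e | S)
      · simp only [Sum.elim_inl]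
        split_ifs with he
        · exact fun _ => hpos e he
        · simp
      · simp only [Sum.elim_inr]
        intro h1
        have h2 : 1 < (M ∩ cut s t S.1).card := by
          have : (1 : ℝ) < (M ∩ cut s t S.1).card := by linarith
          exact_mod_cast this
        obtain ⟨h3, h4⟩ := hnontriv S.1 S.2 h2
        refine lt_of_le_of_ne (sub_nonneg.2 (h.odd S.1 S.2)) fun h5 => hnt S.1 ⟨S.2, h3, h4, ?_⟩
        linarith)
    (by
      obtain ⟨v⟩ := ‹Nonempty V›
      obtain ⟨e, he⟩ := Finset.card_pos.1 (by rw [hM.card_star v]; norm_num)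
      refine ⟨.inl e, ?_⟩
      simp [(Finset.mem_inter.1 he).1])
  have hsum : ∀ S, ∑ e ∈ cut s t S, (w e - if e ∈ M then ε else 0) =
      ∑ e ∈ cut s t S, w e - ε * (M ∩ cut s t S).card := by
    intro S
    rw [Finset.sum_sub_distrib, ← Finset.sum_filter, Finset.filter_mem_eq_inter, Finset.inter_comm]
    simp [mul_comm]
  refine ⟨M, ε, hM, hε, ⟨?_, ?_, ?_, ?_⟩, ?_⟩
  · intro e
    have := hle (.inl e)
    simp only [Sum.elim_inl] at this
    split_ifs at this ⊢ <;> linarith [h.nonneg e]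
  · intro e he
    have : e ∉ M := fun h' => hM.ne e h' he
    simp [this, h.loop e he]
  · intro v
    rw [hsum, h.star, hM.card_star]; simp
  · intro S hS
    have := hle (.inr ⟨S, hS⟩)
    simp only [Sum.elim_inr] at this
    rw [hsum]; linarith
  · rcases i with e | S
    · left
      simp only [Sum.elim_inl] at hi hieq
      by_cases he : e ∈ M
      · refine ⟨e, hpos e he, ?_⟩
        simp only [he, if_true] at hieq ⊢
        linarith
      · simp [he] at hi
    · right
      simp only [Sum.elim_inr] at hi hieq
      have h2 : 1 < (M ∩ cut s t S.1).card := by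
        have : (1 : ℝ) < (M ∩ cut s t S.1).card := by linarith
        exact_mod_cast this
      obtain ⟨h3, h4⟩ := hnontriv S.1 S.2 h2
      refine ⟨S.1, S.2, h3, h4, ?_⟩
      rw [hsum]; linarith

lemma IsPMSum.add_indicator {V E : Type*} [DecidableEq V] [Fintype E] [DecidableEq E]
    {s t : E → V} {w : E → ℝ} {M : Finset E} {ε : ℝ} (hM : IsPM s t M) (hε : 0 < ε)
    (h : IsPMSum s t fun e => w e - if e ∈ M then ε else 0) : IsPMSum s t w := by
  obtain ⟨l, h0, hl, hw⟩ := h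
  refine ⟨fun N => l N + if N = M then ε else 0, fun N => ?_, fun N hN => ?_, fun e => ?_⟩
  · have := h0 N
    dsimp only
    split_ifs <;> linarith
  · by_cases hNM : N = M
    · exact hNM ▸ hM
    · exact hl N (by simpa [hNM] using hN)
  · have h1 : ∀ N, (if e ∈ N then l N + (if N = M then ε else 0) else 0) =
        (if e ∈ N then l N else 0) + if N = M then (if e ∈ M then ε else 0) else 0 := by
      intro N
      by_cases hNM : N = M
      · subst hNM; split_ifs <;> simp
      · simp [hNM]
    simp only [h1, Finset.sum_add_distrib, ← hw e, Finset.sum_ite_eq', Finset.mem_univ, if_true]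
    ring

universe u v

/-- **Edmonds' perfect matching polytope theorem**, for the cone. -/
theorem InCone.isPMSum {E : Type v} [Fintype E] [DecidableEq E] :
    ∀ (n : ℕ) {V : Type u} [Fintype V] [DecidableEq V], Fintype.card V = n →
    ∀ {s t : E → V} {w : E → ℝ} {τ : ℝ}, InCone s t w τ → IsPMSum s t w := by
  intro n
  induction n using Nat.strong_induction_on with
  | _ n ih =>
    intro V _ _ hV s t
    have tightCase : ∀ {w : E → ℝ} {τ : ℝ} {S : Finset V}, InCone s t w τ → 0 < τ →
        IsNontrivialTight s t w τ S → IsPMSum s t w := by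
      intro w τ S h hτ hS
      have hSc : Odd Sᶜ.card := by
        obtain ⟨M, hM, -⟩ := h.exists_isPM hτ
        have h1 := hM.card_inter_cut_mod_two S
        have h2 := hM.card_inter_cut_mod_two Sᶜ
        have h3 := hS.odd
        rw [Nat.odd_iff] at h3 ⊢
        rw [cut_compl] at h2
        omega
      obtain ⟨l, h0, hl, hw⟩ := h.exists_isPMOn hS.odd hS.tight fun w' hw' =>
        ih _ (hV ▸ card_option_notMem_lt hS.one_lt) rfl hw'
      obtain ⟨l', h0', hl', hw'⟩ := h.exists_isPMOn hSc (by rw [cut_compl, hS.tight])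
        fun w' hw' => ih _ (hV ▸ card_option_notMem_lt hS.one_lt_compl) rfl hw'
      rw [compl_compl] at hl' hw'
      exact isPMSum_of_isPMOn h0 h0' h.nonneg hl hl' hw hw'
    suffices ∀ (m : ℕ) {w : E → ℝ} {τ : ℝ}, (Finset.univ.filter fun e => 0 < w e).card = m →
        InCone s t w τ → IsPMSum s t w from fun {w τ} h => this _ rfl h
    intro m
    induction m using Nat.strong_induction_on with
    | _ m ihm =>
      intro w τ hm h
      rcases le_or_gt τ 0 with hτ | hτ
      · exact .of_tau_nonpos h hτ
      rcases isEmpty_or_nonempty V with hemp | hne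
      · exact ⟨0, by simp, by simp, fun e => isEmptyElim (s e)⟩
      by_cases hnt : ∃ S, IsNontrivialTight s t w τ S
      · obtain ⟨S, hS⟩ := hnt
        exact tightCase h hτ hS
      obtain ⟨M, ε, hM, hε, hcone, hcase⟩ := h.exists_sub hτ (not_exists.1 hnt)
      refine .add_indicator hM hε ?_
      rcases le_or_gt (τ - ε) 0 with hτ' | hτ'
      · exact .of_tau_nonpos hcone hτ'
      rcases hcase with ⟨e, he, he0⟩ | ⟨S, hS⟩
      · refine ihm _ ?_ rfl hcone
        rw [← hm]
        refine Finset.card_lt_card ⟨fun f hf => ?_, fun hsub => ?_⟩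
        · simp only [Finset.mem_filter, Finset.mem_univ, true_and] at hf ⊢
          split_ifs at hf <;> linarith
        · have := (Finset.mem_filter.1 (hsub (Finset.mem_filter.2 ⟨Finset.mem_univ e, he⟩))).2
          exact this.ne' he0
      · exact tightCase hcone hτ' hS

end Main

end Multigraph

namespace Multigraph

lemma InCone.exists_isPM_le {V E : Type*} [Fintype V] [Nonempty V] [DecidableEq V] [Fintype E]
    [DecidableEq E] {s t : E → V} {w : E → ℝ} (h : InCone s t w 1) (c : E → ℝ) :
    ∃ M, IsPM s t M ∧
      (∀ S : Finset V, Odd S.card → ∑ e ∈ cut s t S, w e = 1 → (M ∩ cut s t S).card = 1) ∧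
      ∑ e, c e * w e ≤ ∑ e ∈ M, c e := by
  obtain ⟨l, h0, hl, hw⟩ := InCone.isPMSum _ rfl h
  have hlin : ∀ f : E → ℝ, ∑ e, f e * w e = ∑ M, l M * ∑ e ∈ M, f e := by
    intro f
    simp only [hw, Finset.mul_sum]
    rw [Finset.sum_comm]
    refine Finset.sum_congr rfl fun M _ => ?_
    simp only [mul_ite, mul_zero]
    rw [← Finset.sum_filter, Finset.filter_mem_eq_inter, Finset.univ_inter]
    exact Finset.sum_congr rfl fun e _ => mul_comm _ _
  have hcut : ∀ S, ∑ e ∈ cut s t S, w e = ∑ M, l M * (M ∩ cut s t S).card := by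
    intro S
    have h1 := hlin fun e => if e ∈ cut s t S then 1 else 0
    simp only [ite_mul, one_mul, zero_mul, Finset.sum_ite_mem, Finset.univ_inter] at h1
    rw [h1]
    simp
  have htot : ∑ M, l M = 1 := by
    obtain ⟨v⟩ := ‹Nonempty V›
    rw [← h.star v, hcut]
    refine Finset.sum_congr rfl fun M _ => ?_
    by_cases hM : l M = 0
    · simp [hM]
    · simp [(hl M hM).card_star v]
  have hex : ∃ M, l M ≠ 0 ∧ ∑ e, c e * w e ≤ ∑ e ∈ M, c e := by
    by_contra! hlt
    obtain ⟨M₀, -, hM₀⟩ := Finset.exists_ne_zero_of_sum_ne_zero (htot.trans_ne one_ne_zero)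
    have h1 : ∑ M, l M * ∑ e ∈ M, c e < ∑ M, l M * ∑ e, c e * w e := by
      refine Finset.sum_lt_sum (fun M _ => ?_) ⟨M₀, Finset.mem_univ _, ?_⟩
      · by_cases hM : l M = 0
        · simp [hM]
        · exact mul_le_mul_of_nonneg_left (hlt M hM).le (h0 M)
      · exact mul_lt_mul_of_pos_left (hlt M₀ hM₀) (lt_of_le_of_ne (h0 M₀) (Ne.symm hM₀))
    rw [← Finset.sum_mul, htot, one_mul, ← hlin] at h1
    exact lt_irrefl _ h1
  obtain ⟨M, hM, hc⟩ := hex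
  refine ⟨M, hl M hM, fun S hS htight => ?_, hc⟩
  have hzero : ∑ N, l N * (((N ∩ cut s t S).card : ℝ) - 1) = 0 := by
    simp only [mul_sub, Finset.sum_sub_distrib, mul_one, ← hcut, htight, htot, sub_self]
  have hge : ∀ N, 0 ≤ l N * (((N ∩ cut s t S).card : ℝ) - 1) := by
    intro N
    by_cases hN : l N = 0
    · simp [hN]
    · have : (1 : ℝ) ≤ (N ∩ cut s t S).card := by
        exact_mod_cast (hl N hN).one_le_card_inter_cut hS
      exact mul_nonneg (h0 N) (by linarith)
  have h2 := (Finset.sum_eq_zero_iff_of_nonneg fun N _ => hge N).1 hzero M (Finset.mem_univ M)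
  have h3 := (mul_eq_zero.1 h2).resolve_left hM
  have h4 : ((M ∩ cut s t S).card : ℝ) = 1 := by linarith
  exact_mod_cast h4

/-- The parameters of the weights `(A k + 2 - x n(e)) / ((r A - x) k + 2 r)`. -/
def IsWeightParam (r A x : ℕ) : Prop :=
  (Odd r ∧ A + 1 = r ∧ x = 2) ∨ (Even r ∧ A + 2 = r ∧ x = 1)

lemma IsWeightParam.le {r A x : ℕ} (h : IsWeightParam r A x) (hr : 3 ≤ r) : x ≤ A := by
  rcases h with ⟨-, h1, h2⟩ | ⟨h0, h1, h2⟩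
  · omega
  · omega

lemma cut_invariant_step {r A x c k σ m : ℕ} (hA : IsWeightParam r A x) (hr : 3 ≤ r) (hrc : r ≤ c)
    (hc : c % 2 = r % 2) (hσ : σ % 2 = k % 2) (hkσ : k ≤ σ) (hm : m % 2 = 1) (hmc : m ≤ c)
    (hinv : x * σ + r * (A * k + 2) ≤ c * (A * k + 2) + x * k)
    (htight : x * σ + r * (A * k + 2) = c * (A * k + 2) + x * k → m = 1) :
    x * (σ + m) + r * (A * (k + 1) + 2) ≤ c * (A * (k + 1) + 2) + x * (k + 1) := by
  obtain ⟨d, rfl⟩ : ∃ d, c = r + 2 * d := ⟨(c - r) / 2, by omega⟩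
  obtain ⟨X, hX⟩ : ∃ X, X = d * (A * k + 2) := ⟨_, rfl⟩
  have e1 : (r + 2 * d) * (A * k + 2) = r * (A * k + 2) + 2 * X := by rw [hX]; ring
  have e2 : (r + 2 * d) * (A * (k + 1) + 2) = r * (A * (k + 1) + 2) + 2 * X + 2 * (d * A) := by
    rw [hX]; ring
  rw [e1] at hinv htight
  rw [e2]
  rcases Nat.eq_zero_or_pos d with rfl | hd
  · have hX0 : X = 0 := by simpa using hX
    subst hX0
    rcases hA with ⟨-, h1, rfl⟩ | ⟨-, h1, rfl⟩
    · have := htight (by omega); omega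
    · have := htight (by omega); omega
  rcases hA with ⟨h0, h1, rfl⟩ | ⟨h0, h1, rfl⟩
  · have hXe : X % 2 = 0 := by
      obtain ⟨b, hb⟩ := h0
      have hA2 : A = 2 * b := by omega
      rw [hX, hA2, show d * (2 * b * k + 2) = 2 * (d * (b * k + 1)) by ring]
      omega
    have hkey : r + 2 * d ≤ d * A + 3 := by
      subst h1
      obtain ⟨b, rfl⟩ : ∃ b, A = b + 2 := ⟨A - 2, by omega⟩
      obtain ⟨d, rfl⟩ : ∃ d', d = d' + 1 := ⟨d - 1, by omega⟩
      nlinarith [Nat.zero_le (d * b)]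
    rcases eq_or_ne m 1 with rfl | hm1
    · omega
    · have : ¬ (2 * σ + r * (A * k + 2) = r * (A * k + 2) + 2 * X + 2 * k) :=
        fun h => hm1 (htight h)
      omega
  · rw [Nat.even_iff] at h0
    have hkey : r + 2 * d ≤ 2 * (d * A) + 4 := by
      subst h1
      obtain ⟨b, rfl⟩ : ∃ b, A = b + 2 := ⟨A - 2, by omega⟩
      obtain ⟨d, rfl⟩ : ∃ d', d = d' + 1 := ⟨d - 1, by omega⟩
      nlinarith [Nat.zero_le (d * b)]
    rcases eq_or_ne m 1 with rfl | hm1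
    · omega
    · have : ¬ (1 * σ + r * (A * k + 2) = r * (A * k + 2) + 2 * X + 1 * k) :=
        fun h => hm1 (htight h)
      omega

/-- An `r`-graph given by its end maps. -/
structure IsEndRGraph {V E : Type*} [DecidableEq V] [Fintype E] (s t : E → V) (r : ℕ) :
    Prop where
  ne : ∀ e, s e ≠ t e
  card_star : ∀ v, (cut s t {v}).card = r
  le_card_cut : ∀ S : Finset V, Odd S.card → r ≤ (cut s t S).card

lemma IsEndRGraph.card_cut_mod_two {V E : Type*} [DecidableEq V] [Fintype E] {s t : E → V}
    {r : ℕ} (h : IsEndRGraph s t r) {S : Finset V} (hS : Odd S.card) :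
    (cut s t S).card % 2 = r % 2 := by
  classical
  have := card_inter_cut_mod_two (M := Finset.univ) (fun e _ => h.ne e) S
  simp only [Finset.univ_inter, h.card_star, Finset.sum_const, smul_eq_mul] at this
  rw [this, Nat.mul_mod, Nat.odd_iff.1 hS, one_mul, Nat.mod_mod]

lemma sum_card_filter_mem {E ι : Type*} [Fintype ι] [DecidableEq E] (M : ι → Finset E)
    (C : Finset E) :
    ∑ e ∈ C, (Finset.univ.filter fun i => e ∈ M i).card = ∑ i, (M i ∩ C).card := by
  simp only [Finset.card_filter]
  rw [Finset.sum_comm]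
  refine Finset.sum_congr rfl fun i _ => ?_
  rw [← Finset.card_filter, Finset.filter_mem_eq_inter, Finset.inter_comm]

/-- The weight of the edge `e` after the perfect matchings `M i` have been chosen. -/
noncomputable def coverWeight {E : Type*} [DecidableEq E] (r A x : ℕ) {k : ℕ}
    (M : Fin k → Finset E) (e : E) : ℝ :=
  (A * k + 2 - x * (Finset.univ.filter fun i => e ∈ M i).card) / ((r * A - x) * k + 2 * r)

section Cover

variable {V E : Type*} [DecidableEq V] [DecidableEq E] {s t : E → V} {r A x : ℕ}

lemma IsWeightParam.denom_pos (hA : IsWeightParam r A x) (hr : 3 ≤ r) (k : ℕ) :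
    (0 : ℝ) < (r * A - x) * k + 2 * r := by
  have h1 : (x : ℝ) ≤ A := by exact_mod_cast hA.le hr
  have h2 : (3 : ℝ) ≤ r := by exact_mod_cast hr
  have h3 : (0 : ℝ) ≤ r * A - x := by nlinarith [(A.cast_nonneg : (0 : ℝ) ≤ A)]
  positivity

lemma sum_coverWeight {k : ℕ} (M : Fin k → Finset E) (C : Finset E) :
    ∑ e ∈ C, coverWeight r A x M e =
      (C.card * (A * k + 2) - x * (∑ i, (M i ∩ C).card : ℕ)) / ((r * A - x) * k + 2 * r) := by
  simp only [coverWeight, ← Finset.sum_div, Finset.sum_sub_distrib, ← Finset.mul_sum,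
    Finset.sum_const, nsmul_eq_mul]
  rw [← sum_card_filter_mem]
  push_cast
  rfl

variable [Fintype E]

lemma inCone_coverWeight (hA : IsWeightParam r A x) (hr : 3 ≤ r) (hG : IsEndRGraph s t r) {k : ℕ}
    {M : Fin k → Finset E} (hM : ∀ i, IsPM s t (M i))
    (hinv : ∀ S : Finset V, Odd S.card → x * ∑ i, (M i ∩ cut s t S).card + r * (A * k + 2) ≤
      (cut s t S).card * (A * k + 2) + x * k) :
    InCone s t (coverWeight r A x M) 1 := by
  have hD := hA.denom_pos hr k
  refine ⟨fun e => div_nonneg ?_ hD.le, fun e he => absurd he (hG.ne e), fun v => ?_,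
    fun S hS => ?_⟩
  · have h1 : (Finset.univ.filter fun i => e ∈ M i).card ≤ k := by
      simpa using Finset.card_le_univ (Finset.univ.filter fun i => e ∈ M i)
    have h2 : x * (Finset.univ.filter fun i => e ∈ M i).card ≤ A * k :=
      Nat.mul_le_mul (hA.le hr) h1
    have h3 : (x : ℝ) * (Finset.univ.filter fun i => e ∈ M i).card ≤ A * k := by exact_mod_cast h2
    linarith
  · rw [sum_coverWeight, div_eq_one_iff_eq hD.ne', hG.card_star]
    simp only [(hM _).card_star, Finset.sum_const, Finset.card_univ, Fintype.card_fin, smul_eq_mul,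
      mul_one]
    ring
  · rw [sum_coverWeight, one_le_div hD]
    have : ((x * ∑ i, (M i ∩ cut s t S).card + r * (A * k + 2) : ℕ) : ℝ) ≤
      ((cut s t S).card * (A * k + 2) + x * k : ℕ) := by exact_mod_cast hinv S hS
    push_cast at this ⊢
    linarith

theorem IsEndRGraph.exists_cover [Fintype V] [Nonempty V] (hA : IsWeightParam r A x) (hr : 3 ≤ r)
    (hG : IsEndRGraph s t r) (k : ℕ) :
    ∃ M : Fin k → Finset E, (∀ i, IsPM s t (M i)) ∧
      (∀ S : Finset V, Odd S.card → x * ∑ i, (M i ∩ cut s t S).card + r * (A * k + 2) ≤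
        (cut s t S).card * (A * k + 2) + x * k) ∧
      ((Finset.univ.filter fun e => ∀ i, e ∉ M i).card : ℝ) ≤ Fintype.card E *
        ∏ i ∈ Finset.range k, (1 - (A * i + 2 : ℝ) / ((r * A - x) * i + 2 * r)) := by
  induction k with
  | zero =>
    refine ⟨Fin.elim0, fun i => i.elim0, fun S hS => ?_, by simp⟩
    have := hG.le_card_cut S hS
    simp only [Finset.univ_eq_empty, Finset.sum_empty]
    omega
  | succ k ih =>
    obtain ⟨M, hM, hinv, hcov⟩ := ih
    set U := Finset.univ.filter fun e => ∀ i, e ∉ M i with hU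
    have hD := hA.denom_pos hr k
    obtain ⟨M₀, hM₀, htight, hle⟩ := (inCone_coverWeight hA hr hG hM hinv).exists_isPM_le
      fun e => if e ∈ U then 1 else 0
    refine ⟨Fin.cons M₀ M, ?_, ?_, ?_⟩
    · intro i
      refine Fin.cases ?_ (fun i => ?_) i
      · simpa using hM₀
      · simpa using hM i
    · intro S hS
      have hσ : (∑ i, (M i ∩ cut s t S).card) % 2 = k % 2 := by
        rw [Finset.sum_nat_mod]
        simp [(hM _).card_inter_cut_mod_two, Nat.odd_iff.1 hS]
      have hkσ : k ≤ ∑ i, (M i ∩ cut s t S).card := by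
        calc k = ∑ i : Fin k, 1 := by simp
          _ ≤ _ := Finset.sum_le_sum fun i _ => (hM i).one_le_card_inter_cut hS
      have := cut_invariant_step hA hr (hG.le_card_cut S hS) (hG.card_cut_mod_two hS) hσ hkσ
        ((hM₀.card_inter_cut_mod_two S).trans (Nat.odd_iff.1 hS))
        (Finset.card_le_card Finset.inter_subset_right) (hinv S hS) (fun heq => htight S hS (by
          rw [sum_coverWeight, div_eq_one_iff_eq hD.ne']
          have h2 : ((x * ∑ i, (M i ∩ cut s t S).card + r * (A * k + 2) : ℕ) : ℝ) =
            ((cut s t S).card * (A * k + 2) + x * k : ℕ) := by exact_mod_cast heq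
          push_cast at h2 ⊢
          linarith))
      rw [Fin.sum_univ_succ]
      simp only [Fin.cons_zero, Fin.cons_succ]
      rw [add_comm (M₀ ∩ cut s t S).card]
      exact this
    · have h1 : (Finset.univ.filter fun e => ∀ i, e ∉ (Fin.cons M₀ M : Fin (k + 1) → _) i) =
          U \ M₀ := by
        ext e
        simp [hU, Fin.forall_fin_succ, and_comm]
      have h2 : ∑ e, (if e ∈ U then 1 else 0) * coverWeight r A x M e =
          U.card * ((A * k + 2 : ℝ) / ((r * A - x) * k + 2 * r)) := by
        rw [← nsmul_eq_mul, ← Finset.sum_const]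
        simp only [ite_mul, one_mul, zero_mul, Finset.sum_ite_mem, Finset.univ_inter]
        refine Finset.sum_congr rfl fun e he => ?_
        have : (Finset.univ.filter fun i => e ∈ M i) = ∅ := by
          simpa [hU, Finset.filter_eq_empty_iff] using he
        simp [coverWeight, this]
      have h3 : ∑ e ∈ M₀, (if e ∈ U then (1 : ℝ) else 0) = (M₀ ∩ U).card := by simp
      have h4 : ((U \ M₀).card : ℝ) = U.card - (M₀ ∩ U).card := by
        rw [eq_sub_iff_add_eq, Finset.inter_comm]
        exact_mod_cast Finset.card_sdiff_add_card_inter U M₀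
      rw [h2, h3] at hle
      have h5 : (0 : ℝ) ≤ 1 - (A * k + 2 : ℝ) / ((r * A - x) * k + 2 * r) := by
        rw [sub_nonneg, div_le_one hD]
        have hxA : (x : ℝ) ≤ A := by exact_mod_cast hA.le hr
        have h3r : (3 : ℝ) ≤ r := by exact_mod_cast hr
        have hA0 : (0 : ℝ) ≤ A := A.cast_nonneg
        have : (A : ℝ) * k ≤ (r * A - x) * k :=
          mul_le_mul_of_nonneg_right (by nlinarith) k.cast_nonneg
        linarith
      rw [h1, h4, Finset.prod_range_succ]
      calc (U.card : ℝ) - (M₀ ∩ U).card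
          ≤ U.card * (1 - (A * k + 2 : ℝ) / ((r * A - x) * k + 2 * r)) := by linarith
        _ ≤ _ := by
          rw [← mul_assoc]
          exact mul_le_mul_of_nonneg_right hcov h5

end Cover

end Multigraph

namespace Multigraph

lemma card_cut_mod_two {V E : Type*} [DecidableEq V] [Fintype E] (s t : E → V) (S : Finset V) :
    (cut s t S).card % 2 = (∑ v ∈ S, (cut s t {v}).card) % 2 := by
  classical
  have h : ∀ T, (Finset.univ.filter fun e => s e ≠ t e) ∩ cut s t T = cut s t T := by
    intro T
    rw [Finset.inter_eq_right]
    exact fun e he => by simpa using ne_of_mem_cut he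
  simpa only [h] using
    card_inter_cut_mod_two (s := s) (t := t) (M := Finset.univ.filter fun e => s e ≠ t e)
      (fun e he => (Finset.mem_filter.1 he).2) S

end Multigraph

namespace Graph

open Multigraph

section Ends

variable {α β : Type*} {G : Graph α β} {r k : ℕ}

lemma exists_ends (G : Graph α β) :
    ∃ s t : G.edgeSet → G.vertexSet, ∀ e : G.edgeSet, G.IsLink e (s e) (t e) := by
  have : ∀ e : G.edgeSet, ∃ p : G.vertexSet × G.vertexSet, G.IsLink e p.1 p.2 := by
    rintro ⟨e, he⟩
    obtain ⟨x, y, h⟩ := G.exists_isLink_of_mem_edgeSet he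
    exact ⟨(⟨x, h.left_mem⟩, ⟨y, h.right_mem⟩), h⟩
  choose p hp using this
  exact ⟨fun e => (p e).1, fun e => (p e).2, hp⟩

variable [DecidableEq G.vertexSet] [Fintype G.edgeSet] {s t : G.edgeSet → G.vertexSet}

lemma edgeCut_image (hst : ∀ e : G.edgeSet, G.IsLink e (s e) (t e)) (S : Finset G.vertexSet) :
    G.edgeCut (Subtype.val '' (S : Set G.vertexSet)) =
      Subtype.val '' (cut s t S : Set G.edgeSet) := by
  have himg : ∀ v : G.vertexSet, v.1 ∈ Subtype.val '' (S : Set G.vertexSet) ↔ v ∈ S := by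
    simp
  ext e
  constructor
  · rintro ⟨x, y, h, hx, hy⟩
    refine ⟨⟨e, h.edge_mem⟩, ?_, rfl⟩
    have h' := hst ⟨e, h.edge_mem⟩
    rw [Finset.mem_coe, mem_cut]
    rcases h.eq_and_eq_or_eq_and_eq h' with ⟨hx', hy'⟩ | ⟨hx', hy'⟩ <;>
    · rw [hx', himg] at hx
      rw [hy', himg] at hy
      tauto
  · rintro ⟨e, he, rfl⟩
    rw [Finset.mem_coe, mem_cut] at he
    by_cases hs : s e ∈ S
    · exact ⟨_, _, hst e, (himg _).2 hs, fun h => he (by simp [hs, (himg _).1 h])⟩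
    · exact ⟨_, _, (hst e).symm, (himg _).2 (by tauto), fun h => hs ((himg _).1 h)⟩

lemma ncard_edgeCut_image (hst : ∀ e : G.edgeSet, G.IsLink e (s e) (t e))
    (S : Finset G.vertexSet) :
    (G.edgeCut (Subtype.val '' (S : Set G.vertexSet))).ncard = (cut s t S).card := by
  rw [edgeCut_image hst, Set.ncard_image_of_injective _ Subtype.val_injective,
    Set.ncard_coe_finset]

lemma card_cut_singleton_add (hG : G.IsFiniteRegular r)
    (hst : ∀ e : G.edgeSet, G.IsLink e (s e) (t e)) (v : G.vertexSet) :
    (cut s t {v}).card + 2 * (G.loopSet v).ncard = r := by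
  have hfin : ∀ X ⊆ G.edgeSet, X.Finite := fun X hX => hG.finite_edgeSet.subset hX
  have hunion : G.incidenceSet v = G.edgeCut {v.1} ∪ G.loopSet v := by
    ext e
    constructor
    · rintro ⟨y, hy⟩
      by_cases h : y = v
      · subst h; exact .inr hy
      · exact .inl ⟨_, _, hy, rfl, h⟩
    · rintro (⟨x, y, h, rfl, -⟩ | h)
      · exact ⟨y, h⟩
      · exact ⟨_, h⟩
  have hdisj : Disjoint (G.edgeCut {v.1}) (G.loopSet v) := by
    rw [Set.disjoint_left]
    rintro e ⟨x, y, h, rfl, hy⟩ h'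
    exact hy (h.right_unique h')
  have hdeg := hG.degree_eq v v.2
  rw [vertexDegree, hunion, Set.ncard_union_eq hdisj
    (hfin _ fun e he => by obtain ⟨x, y, h, -⟩ := he; exact h.edge_mem)
    (hfin _ fun e he => he.edge_mem)] at hdeg
  have := ncard_edgeCut_image hst {v}
  rw [Finset.coe_singleton, Set.image_singleton] at this
  omega

lemma IsRGraph.isEndRGraph (hG : G.IsRGraph r)
    (hst : ∀ e : G.edgeSet, G.IsLink e (s e) (t e)) : IsEndRGraph s t r := by
  have hle : ∀ S : Finset G.vertexSet, Odd S.card → r ≤ (cut s t S).card := by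
    intro S hS
    rw [← ncard_edgeCut_image hst]
    refine hG.le_edgeCut _ (by rintro _ ⟨v, -, rfl⟩; exact v.2) ?_
    rwa [Set.ncard_image_of_injective _ Subtype.val_injective, Set.ncard_coe_finset]
  refine ⟨fun e he => ?_, fun v => ?_, hle⟩
  · have h1 := card_cut_singleton_add hG.toIsFiniteRegular hst (s e)
    have h2 := hle {s e} (by simp)
    have h3 : (G.loopSet (s e)).ncard = 0 := by omega
    rw [Set.ncard_eq_zero (hG.finite_edgeSet.subset fun e he => he.edge_mem)] at h3
    have h4 := hst e
    rw [← he] at h4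
    exact (Set.eq_empty_iff_forall_notMem.1 h3 e) h4
  · have h1 := card_cut_singleton_add hG.toIsFiniteRegular hst v
    have h2 := hle {v} (by simp)
    omega

lemma isOneFactor_image [DecidableEq G.edgeSet]
    (hst : ∀ e : G.edgeSet, G.IsLink e (s e) (t e)) {M : Finset G.edgeSet} (hM : IsPM s t M) :
    G.IsOneFactor (Subtype.val '' (M : Set G.edgeSet)) := by
  refine ⟨?_, ?_, ?_⟩
  · rintro _ ⟨e, -, rfl⟩; exact e.2
  · rintro _ ⟨e, he, rfl⟩ x hx
    refine hM.ne e he ?_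
    rw [Subtype.ext_iff]
    rcases (hst e).eq_and_eq_or_eq_and_eq hx with ⟨h1, h2⟩ | ⟨h1, h2⟩ <;> rw [h1, h2]
  · intro x hx
    have hinc : ∀ e ∈ M, G.Inc e x ↔ e ∈ cut s t {⟨x, hx⟩} := by
      intro e he
      rw [mem_cut_singleton, Subtype.ext_iff, Subtype.ext_iff]
      constructor
      · intro h
        refine ⟨hM.ne e he, ?_⟩
        rcases h.eq_or_eq_of_isLink (hst e) with h | h
        exacts [.inl h.symm, .inr h.symm]
      · rintro ⟨-, rfl | rfl⟩
        exacts [(hst e).inc_left, (hst e).inc_right]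
    obtain ⟨e, he⟩ := Finset.card_eq_one.1 (hM.card_star ⟨x, hx⟩)
    have he' := Finset.mem_inter.1 (he ▸ Finset.mem_singleton_self e)
    refine ⟨e, ⟨⟨e, he'.1, rfl⟩, (hinc e he'.1).2 he'.2⟩, ?_⟩
    rintro _ ⟨⟨f, hf, rfl⟩, hfx⟩
    have : f ∈ M ∩ cut s t {⟨x, hx⟩} := Finset.mem_inter.2 ⟨hf, (hinc f hf).1 hfx⟩
    rw [he, Finset.mem_singleton] at this
    rw [this]

end Ends

variable {α β : Type*} {G : Graph α β} {r k : ℕ}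

lemma le_maxCover (hfin : G.edgeSet.Finite) {M : Fin k → Set β} (hM : ∀ i, G.IsOneFactor (M i)) :
    ((⋃ i, M i).ncard : ℝ) / (G.edgeSet.ncard : ℝ) ≤ G.maxCover k := by
  refine le_csSup ⟨1, ?_⟩ ⟨M, hM, rfl⟩
  rintro _ ⟨N, hN, rfl⟩
  refine div_le_one_of_le₀ ?_ (Nat.cast_nonneg _)
  exact_mod_cast Set.ncard_le_ncard (Set.iUnion_subset fun i => (hN i).subset_edgeSet) hfin

lemma IsRGraph.one_sub_prod_le_maxCover (hG : G.IsRGraph r) (hr : 3 ≤ r) {A x : ℕ}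
    (hA : IsWeightParam r A x) :
    1 - ∏ i ∈ Finset.range k, (1 - (A * i + 2 : ℝ) / ((r * A - x) * i + 2 * r)) ≤
      G.maxCover k := by
  classical
  obtain ⟨s, t, hst⟩ := G.exists_ends
  have : Fintype G.vertexSet := hG.finite_vertexSet.fintype
  have : Fintype G.edgeSet := hG.finite_edgeSet.fintype
  have : Nonempty G.vertexSet := hG.nonempty.to_subtype
  have hE := hG.isEndRGraph hst
  obtain ⟨M, hM, -, hcov⟩ := hE.exists_cover hA hr k
  refine le_trans ?_ (le_maxCover hG.finite_edgeSet fun i => isOneFactor_image hst (hM i))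
  have hcard : G.edgeSet.ncard = Fintype.card G.edgeSet := by
    rw [← Nat.card_coe_set_eq, Nat.card_eq_fintype_card]
  have hpos : (0 : ℝ) < Fintype.card G.edgeSet := by
    obtain ⟨v⟩ := ‹Nonempty G.vertexSet›
    have h1 := hE.card_star v
    have h2 := Finset.card_le_univ (cut s t {v})
    exact_mod_cast (by omega : 0 < Fintype.card G.edgeSet)
  have hunion : (⋃ i, Subtype.val '' (M i : Set G.edgeSet)) =
      Subtype.val '' (((Finset.univ.filter fun e => ∀ i, e ∉ M i)ᶜ : Finset G.edgeSet) : Set G.edgeSet) := by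
    ext e
    simp [exists_comm (α := Fin k)]
  rw [hunion, Set.ncard_image_of_injective _ Subtype.val_injective, Set.ncard_coe_finset,
    hcard, le_div_iff₀ hpos, Finset.card_compl, Nat.cast_sub (Finset.card_le_univ _)]
  linarith

lemma IsFiniteRegular.isRGraph_three (hG : G.IsFiniteRegular 3) (hb : ∀ e, ¬ G.IsBridge e) :
    G.IsRGraph 3 := by
  classical
  refine ⟨hG, fun S hS hodd => ?_⟩
  obtain ⟨s, t, hst⟩ := G.exists_ends
  have : Fintype G.vertexSet := hG.finite_vertexSet.fintype
  have : Fintype G.edgeSet := hG.finite_edgeSet.fintype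
  set T : Finset G.vertexSet := Finset.univ.filter fun v => v.1 ∈ S with hT
  have hTS : Subtype.val '' (T : Set G.vertexSet) = S := by
    ext x
    simp only [hT, Finset.coe_filter, Finset.mem_univ, true_and, Set.mem_image,
      Set.mem_ofPred_eq, Subtype.exists, exists_and_left, exists_prop, exists_eq_right_right]
    exact ⟨fun h => h.1, fun h => ⟨h, hS h⟩⟩
  have hTodd : Odd T.card := by
    rwa [← hTS, Set.ncard_image_of_injective _ Subtype.val_injective, Set.ncard_coe_finset]
      at hodd
  have hpar : (cut s t T).card % 2 = 1 := by
    rw [card_cut_mod_two, Finset.sum_nat_mod, Finset.sum_congr rfl fun v _ =>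
      show (cut s t {v}).card % 2 = 1 by have := card_cut_singleton_add hG hst v; omega]
    simpa using Nat.odd_iff.1 hTodd
  have hne : (G.edgeCut S).ncard ≠ 1 := by
    intro h1
    obtain ⟨e, he⟩ := Set.ncard_eq_one.1 h1
    obtain ⟨x, y, hxy, hx, hy⟩ : e ∈ G.edgeCut S := he ▸ rfl
    refine hb e ⟨x, y, hxy, fun hpath => hy ?_⟩
    clear hxy hy
    induction hpath with
    | refl => exact hx
    | tail _ hadj ih =>
      by_contra hz
      obtain ⟨f, hf⟩ := hadj
      rw [deleteEdges_isLink] at hf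
      exact hf.2 (he ▸ ⟨_, _, hf.1, ih, hz⟩ : f ∈ ({e} : Set β))
  have := ncard_edgeCut_image hst T
  rw [hTS] at this
  omega

lemma isRGraph_banana (r : ℕ) : (banana false true (Set.univ : Set (Fin r))).IsRGraph r := by
  have hcut : ∀ x, (banana false true (Set.univ : Set (Fin r))).edgeCut {x} = Set.univ := by
    intro x
    ext e
    simp only [edgeCut, Set.mem_ofPred_eq, Set.mem_univ, iff_true]
    refine ⟨x, !x, ?_, rfl, by simp⟩
    cases x <;> simp [banana]
  refine ⟨⟨Set.toFinite _, Set.toFinite _, ⟨false, by simp [banana]⟩, fun x _ => ?_⟩,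
    fun S _ hodd => ?_⟩
  · have h1 : (banana false true (Set.univ : Set (Fin r))).incidenceSet x = Set.univ := by
      ext e; cases x <;> simp
    have h2 : (banana false true (Set.univ : Set (Fin r))).loopSet x = ∅ := by
      ext e; simp
    rw [vertexDegree, h1, h2, Set.ncard_univ]; simp
  · have h1 : S.ncard ≤ 2 := by
      simpa [Set.ncard_univ] using Set.ncard_le_ncard (Set.subset_univ S)
    obtain ⟨x, rfl⟩ := Set.ncard_eq_one.1 (by rw [Nat.odd_iff] at hodd; omega : S.ncard = 1)
    rw [hcut, Set.ncard_univ]; simp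

lemma le_minCover {r k : ℕ} {a : ℝ}
    (h : ∀ (α β : Type) (G : Graph α β), G.IsRGraph r → a ≤ G.maxCover k) :
    a ≤ minCover r k := by
  refine le_csInf ⟨_, Bool, Fin r, _, isRGraph_banana r, rfl⟩ ?_
  rintro _ ⟨α, β, G, hG, rfl⟩
  exact h α β G hG

end Graph

lemma prod_Icc_one_eq_prod_range (f : ℕ → ℝ) (k : ℕ) :
    ∏ i ∈ Finset.Icc 1 k, f i = ∏ i ∈ Finset.range k, f (i + 1) := by
  rw [Finset.range_eq_Ico, Finset.prod_Ico_add' f 0 k 1]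
  rfl

theorem mainTheorem2 (r k : ℕ) (hr : 3 ≤ r) (hk : 1 ≤ k) :
    (Even r → Graph.minCover r k ≥ 1 - ∏ i ∈ Finset.Icc 1 k,
      (((r : ℝ) ^ 2 - 3 * r + 1) * (i : ℝ) - ((r : ℝ) ^ 2 - 5 * r + 3)) /
        (((r : ℝ) ^ 2 - 2 * r - 1) * (i : ℝ) - ((r : ℝ) ^ 2 - 4 * r - 1))) ∧
    (Odd r → Graph.minCover r k ≥ 1 - ∏ i ∈ Finset.Icc 1 k,
      (((r : ℝ) ^ 2 - 2 * r - 1) * (i : ℝ) - ((r : ℝ) ^ 2 - 4 * r + 1)) /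
        (((r : ℝ) ^ 2 - r - 2) * (i : ℝ) - ((r : ℝ) ^ 2 - 3 * r - 2))) ∧
    (r = 3 →
      Graph.minCover 3 k ≥ 1 - ∏ i ∈ Finset.Icc 1 k, ((i : ℝ) + 1) / (2 * (i : ℝ) + 1) ∧
      ∀ (α β : Type) (G : Graph α β), G.IsFiniteRegular 3 → (∀ e, ¬ G.IsBridge e) →
        G.maxCover k ≥ 1 - ∏ i ∈ Finset.Icc 1 k, ((i : ℝ) + 1) / (2 * (i : ℝ) + 1)) := by
  refine ⟨fun heven => ?_, fun hodd => ?_, fun _ => ?_⟩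
  · obtain ⟨A, rfl⟩ : ∃ A, r = A + 2 := ⟨r - 2, by omega⟩
    have hA : Multigraph.IsWeightParam (A + 2) A 1 := .inr ⟨heven, rfl, rfl⟩
    refine Graph.le_minCover fun α β G hG => ?_
    refine le_of_eq_of_le ?_ (hG.one_sub_prod_le_maxCover hr hA)
    rw [prod_Icc_one_eq_prod_range]
    refine congrArg _ (Finset.prod_congr rfl fun i _ => ?_)
    rw [one_sub_div (hA.denom_pos hr i).ne']
    push_cast
    congr 1 <;> ring
  · obtain ⟨A, rfl⟩ : ∃ A, r = A + 1 := ⟨r - 1, by omega⟩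
    have hA : Multigraph.IsWeightParam (A + 1) A 2 := .inl ⟨hodd, rfl, rfl⟩
    refine Graph.le_minCover fun α β G hG => ?_
    refine le_of_eq_of_le ?_ (hG.one_sub_prod_le_maxCover hr hA)
    rw [prod_Icc_one_eq_prod_range]
    refine congrArg _ (Finset.prod_congr rfl fun i _ => ?_)
    rw [one_sub_div (hA.denom_pos hr i).ne']
    push_cast
    congr 1 <;> ring
  · have hA : Multigraph.IsWeightParam 3 2 2 := .inl ⟨by decide, rfl, rfl⟩
    have key : ∀ (α β : Type) (G : Graph α β), G.IsRGraph 3 →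
        1 - ∏ i ∈ Finset.Icc 1 k, ((i : ℝ) + 1) / (2 * (i : ℝ) + 1) ≤ G.maxCover k := by
      intro α β G hG
      refine le_of_eq_of_le ?_ (hG.one_sub_prod_le_maxCover le_rfl hA)
      rw [prod_Icc_one_eq_prod_range]
      refine congrArg _ (Finset.prod_congr rfl fun i _ => ?_)
      have h0 := hA.denom_pos le_rfl i
      rw [one_sub_div h0.ne']
      push_cast at h0 ⊢
      rw [div_eq_div_iff (by positivity) h0.ne']
      ring
    exact ⟨Graph.le_minCover key, fun α β G hG hb => key α β G (hG.isRGraph_three hb)⟩
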